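/- Let $k$ be an infinite field. A $k$-algebra means a $k$-vector space with a $k$-bilinear multiplication, not assumed associative, commutative or unital; for such an algebra $B$ put $Z(B)=\{x\in B : xB=Bx=\{0\}\}$. Let $(A_i)_{i\in I}$ be a family of $k$-algebras, $B$ a $k$-algebra, and $f:A=\prod_{i\in I}A_i\to B$ a surjective $k$-algebra homomorphism. Suppose that either (i) $\dim_k(B)<\operatorname{card}(k)$, or (ii) $\dim_k(B)<2^{\aleph_0}$. Then the composite homomorphism $A\to B\to B/Z(B)$ can be factored as a composite of $k$-algebra homomorphisms $$A\to A/\mathcal U_0\times\dots\times A/\mathcal U_{n-1}\to B/Z(B)\qquad(n\in\omega),$$ where the $\mathcal U_m$ are ultrafilters on $I$, the first map is the product of the quotient maps onto the ultraproducts $A/\mathcal U_m$ (in which $(a_i)\sim(b_i)$ iff $\{i : a_i=b_i\}\in\mathcal U_m$), and the $\mathcal U_m$ are $\operatorname{card}(k)^+$-complete in case (i), and countably complete in case (ii). (A filter is $\kappa$-complete if it is closed under intersections of families of fewer than $\kappa$ members; countably complete means $\aleph_1$-complete.) Call an infinite cardinal $\kappa$ measurable if there is a nonprincipal $\kappa$-complete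 ultrafilter on $\kappa$ (so $\aleph_0$ counts as measurable). If $\operatorname{card}(I)$ is less than every measurable cardinal $>\operatorname{card}(k)$ in case (i), or less than every uncountable measurable cardinal in case (ii) (in particular, in either case, if no such measurable cardinals exist), then $A\to B\to B/Z(B)$ factors through the projection of $A$ onto a finite subproduct $A_{i_0}\times\dots\times A_{i_{n-1}}$ ($i_0,\dots,i_{n-1}\in I$). In that situation, $f=f_1+f_0$, where $f_1:A\to B$ is a $k$-algebra homomorphism that factors through the projection of $A$ onto that same finite subproduct, and $f_0:A\to B$ is a $k$-algebra homomorphism with image in $Z(B)$. -/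

import Mathlib

open Cardinal

universe u v w a

section Algebras

/-!
Throughout, a `k`-algebra is a `k`-module with a `k`-bilinear multiplication, not assumed
associative, commutative or unital: `NonUnitalNonAssocRing`, `Module`, `IsScalarTower`,
`SMulCommClass`. Homomorphisms of such algebras are `A →ₙₐ[k] B`.
-/

/-- A two-sided ideal of a `k`-algebra: a `k`-submodule absorbing multiplication on both sides. -/
structure AlgIdeal (k : Type v) (A : Type w) [CommRing k] [NonUnitalNonAssocRing A] [Module k A]
    extends Submodule k A where
  mul_mem_left : ∀ (x : A) {y : A}, y ∈ carrier → x * y ∈ carrier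
  mul_mem_right : ∀ {x : A} (y : A), x ∈ carrier → x * y ∈ carrier

namespace AlgIdeal

variable {k : Type v} {A : Type w} [CommRing k] [NonUnitalNonAssocRing A] [Module k A]

/-- The quotient of a `k`-algebra by a two-sided ideal. -/
def Quotient (Z : AlgIdeal k A) : Type w := A ⧸ Z.toSubmodule

instance (Z : AlgIdeal k A) : AddCommGroup Z.Quotient :=
  inferInstanceAs (AddCommGroup (A ⧸ Z.toSubmodule))

instance (Z : AlgIdeal k A) : Module k Z.Quotient :=
  inferInstanceAs (Module k (A ⧸ Z.toSubmodule))

/-- The class of an element in the quotient algebra. -/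
def cls (Z : AlgIdeal k A) (x : A) : Z.Quotient := Z.toSubmodule.mkQ x

theorem cls_surjective (Z : AlgIdeal k A) : Function.Surjective Z.cls :=
  Z.toSubmodule.mkQ_surjective

theorem cls_eq_iff (Z : AlgIdeal k A) {x y : A} : Z.cls x = Z.cls y ↔ x - y ∈ Z.toSubmodule :=
  Submodule.Quotient.eq Z.toSubmodule

theorem cls_add (Z : AlgIdeal k A) (x y : A) : Z.cls (x + y) = Z.cls x + Z.cls y := rfl

theorem cls_smul (Z : AlgIdeal k A) (c : k) (x : A) : Z.cls (c • x) = c • Z.cls x := rfl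

instance (Z : AlgIdeal k A) : Mul Z.Quotient :=
  ⟨Quotient.map₂ (· * ·) (by
    intro x x' hx y y' hy
    have hx' : x - x' ∈ Z.toSubmodule := (Submodule.quotientRel_def _).mp hx
    have hy' : y - y' ∈ Z.toSubmodule := (Submodule.quotientRel_def _).mp hy
    refine (Submodule.quotientRel_def _).mpr ?_
    have h : x * y - x' * y' = (x - x') * y + x' * (y - y') := by
      rw [sub_mul, mul_sub]; abel
    rw [h]
    exact Z.toSubmodule.add_mem (Z.mul_mem_right y hx') (Z.mul_mem_left x' hy'))⟩

theorem cls_mul (Z : AlgIdeal k A) (x y : A) : Z.cls (x * y) = Z.cls x * Z.cls y := rfl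

instance (Z : AlgIdeal k A) : NonUnitalNonAssocRing Z.Quotient :=
  { (inferInstance : AddCommGroup Z.Quotient), (inferInstance : Mul Z.Quotient) with
    left_distrib := by
      intro p q r
      obtain ⟨x, rfl⟩ := Z.cls_surjective p
      obtain ⟨y, rfl⟩ := Z.cls_surjective q
      obtain ⟨z, rfl⟩ := Z.cls_surjective r
      exact congrArg Z.cls (mul_add x y z)
    right_distrib := by
      intro p q r
      obtain ⟨x, rfl⟩ := Z.cls_surjective p
      obtain ⟨y, rfl⟩ := Z.cls_surjective q
      obtain ⟨z, rfl⟩ := Z.cls_surjective r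
      exact congrArg Z.cls (add_mul x y z)
    zero_mul := by
      intro p
      obtain ⟨x, rfl⟩ := Z.cls_surjective p
      exact congrArg Z.cls (zero_mul x)
    mul_zero := by
      intro p
      obtain ⟨x, rfl⟩ := Z.cls_surjective p
      exact congrArg Z.cls (mul_zero x) }

instance (Z : AlgIdeal k A) [IsScalarTower k A A] : IsScalarTower k Z.Quotient Z.Quotient where
  smul_assoc := by
    intro c p q
    obtain ⟨x, rfl⟩ := Z.cls_surjective p
    obtain ⟨y, rfl⟩ := Z.cls_surjective q
    exact congrArg Z.cls (smul_mul_assoc c x y)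

instance (Z : AlgIdeal k A) [SMulCommClass k A A] : SMulCommClass k Z.Quotient Z.Quotient where
  smul_comm := by
    intro c p q
    obtain ⟨x, rfl⟩ := Z.cls_surjective p
    obtain ⟨y, rfl⟩ := Z.cls_surjective q
    exact congrArg Z.cls (mul_smul_comm c x y).symm

/-- The quotient homomorphism of `k`-algebras. -/
def mkHom (Z : AlgIdeal k A) : A →ₙₐ[k] Z.Quotient where
  toFun := Z.cls
  map_smul' := Z.cls_smul
  map_zero' := rfl
  map_add' := Z.cls_add
  map_mul' := Z.cls_mul

end AlgIdeal

/-- The total annihilator ideal `Z(B) = {x | xB = Bx = 0}`. -/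
def totalAnnihilator (k : Type v) (B : Type w) [CommRing k] [NonUnitalNonAssocRing B] [Module k B]
    [IsScalarTower k B B] [SMulCommClass k B B] : AlgIdeal k B where
  carrier := {x | ∀ y : B, x * y = 0 ∧ y * x = 0}
  add_mem' := by
    intro x x' hx hx' y
    simp [add_mul, mul_add, hx y, hx' y]
  zero_mem' := by intro y; simp
  smul_mem' := by
    intro c x hx y
    simp [smul_mul_assoc, mul_smul_comm, hx y]
  mul_mem_left := by
    intro x y hy z
    simp [(hy x).2]
  mul_mem_right := by
    intro x y hx z
    simp [(hx y).1]

/-- The ideal of those elements of `∏ A_i` that vanish at `F`-almost all indices. -/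
def reducedIdeal (k : Type v) {I : Type u} (A : I → Type a) [CommRing k]
    [∀ i, NonUnitalNonAssocRing (A i)] [∀ i, Module k (A i)] (F : Filter I) :
    AlgIdeal k (∀ i, A i) where
  carrier := {x | ∀ᶠ i in F, x i = 0}
  add_mem' := by
    intro x y hx hy
    filter_upwards [hx, hy] with i h h'
    simp [h, h']
  zero_mem' := Filter.Eventually.of_forall fun _ => rfl
  smul_mem' := by
    intro c x hx
    filter_upwards [hx] with i h
    simp [h]
  mul_mem_left := by
    intro x y hy
    filter_upwards [hy] with i h
    simp [h]
  mul_mem_right := by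
    intro x y hx
    filter_upwards [hx] with i h
    simp [h]

/-- The reduced product `(∏ A_i) / F`; for `F` an ultrafilter, the ultraproduct. -/
abbrev ReducedProduct (k : Type v) {I : Type u} (A : I → Type a) [CommRing k]
    [∀ i, NonUnitalNonAssocRing (A i)] [∀ i, Module k (A i)] (F : Filter I) : Type (max u a) :=
  (reducedIdeal k A F).Quotient

/-- Two families are identified in the reduced product iff they agree on a member of `F`. -/
theorem reducedIdeal_mk_eq_iff (k : Type v) {I : Type u} (A : I → Type a) [CommRing k]
    [∀ i, NonUnitalNonAssocRing (A i)] [∀ i, Module k (A i)] (F : Filter I) (x y : ∀ i, A i) :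
    (reducedIdeal k A F).mkHom x = (reducedIdeal k A F).mkHom y ↔ {i | x i = y i} ∈ F := by
  refine (AlgIdeal.cls_eq_iff _).trans ?_
  change (∀ᶠ i in F, (x - y) i = 0) ↔ ∀ᶠ i in F, x i = y i
  simp [sub_eq_zero]

end Algebras

section Completeness

/-- A filter is `κ`-complete if it is closed under intersections of fewer than `κ` members.
The set and the cardinal may live in different universes. -/
def IsCompleteFilter {I : Type u} (F : Filter I) (κ : Cardinal.{v}) : Prop :=
  ∀ S : Set (Set I), lift.{v} #S < lift.{u} κ → (∀ J ∈ S, J ∈ F) → ⋂₀ S ∈ F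

/-- An infinite cardinal `κ` is measurable if there is a nonprincipal `κ`-complete ultrafilter
on `κ`. With this convention `ℵ₀` is measurable. -/
def IsMeasurableCardinal (κ : Cardinal.{u}) : Prop :=
  ℵ₀ ≤ κ ∧ ∃ U : Ultrafilter κ.out, (∀ x : κ.out, U ≠ pure x) ∧ IsCompleteFilter (U : Filter κ.out) κ

end Completeness

section Factorizations

variable {k : Type v} {I : Type u} {A : I → Type a} {B : Type w} [CommRing k]
  [∀ i, NonUnitalNonAssocRing (A i)] [∀ i, Module k (A i)]
  [NonUnitalNonAssocRing B] [Module k B]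

/-- The homomorphism `h` on `A = ∏ A_i` factors, as a `k`-algebra homomorphism, as
`A → A/U_0 × ⋯ × A/U_{n-1} → B` for finitely many `κ`-complete ultrafilters `U_m`. -/
def FactorsThroughUltraproducts (h : (∀ i, A i) →ₙₐ[k] B) (κ : Cardinal.{v}) : Prop :=
  ∃ (n : ℕ) (U : Fin n → Ultrafilter I),
    (∀ m, IsCompleteFilter (U m : Filter I) κ) ∧
    ∃ g : (∀ m : Fin n, ReducedProduct k A (U m : Filter I)) →ₙₐ[k] B,
      ∀ x : ∀ i, A i, h x = g fun m => (reducedIdeal k A (U m : Filter I)).mkHom x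

/-- The homomorphism `h` on `∏ A_i` factors, as a `k`-algebra homomorphism, through the
projection to the subproduct indexed by the finite set `s`. -/
def FactorsThroughSubproduct (h : (∀ i, A i) →ₙₐ[k] B) (s : Finset I) : Prop :=
  ∃ g : (∀ i : s, A i) →ₙₐ[k] B, ∀ x : ∀ i, A i, h x = g fun i => x i

end Factorizations

/-! Call a set of indices large if `f` sends every family vanishing on it into Z(B); the large sets
form a filter G, `nullFilter f`. Everything follows from one property: modulo G, each map c from I
to C takes finitely many values, where C is k in case (i) and ℕ in case (ii). To see this, fix y in
A and consider the linear map u ↦ f((u(c i) y i)) from C → k to B. Since B is small, it kills some u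
with only finitely many zeros. Wherever u is nonzero it can be divided out against the other factor
of a product, so the part of y over the nonzeros of u goes into Z(B). `finitelyValued_nullFilter`
makes the finite exceptional set independent of y. Hence only finitely many ultrafilters refine G,
and each is complete for families of size card C. As G is their intersection, the map to B/Z(B)
factors through their ultraproducts. A nonprincipal one would give a measurable cardinal above card
C and at most card I; without it, G contains a finite set. -/

/-! ### Linear maps out of function spaces -/

open Polynomial in
/-- A nontrivial combination of the functions `x ↦ (α - x)⁻¹` has finitely many zeros. -/
theorem finite_zeros_sum_inv_sub {k : Type v} [Field k] (s : Finset k) (β : k → k) {j : k}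
    (hj : j ∈ s) (hβ : β j ≠ 0) : {x : k | ∑ α ∈ s, β α * (α - x)⁻¹ = 0}.Finite := by
  classical
  -- P is the numerator over the common denominator; at j only the j-th term survives.
  set P : k[X] := ∑ α ∈ s, C (β α) * ∏ l ∈ s.erase α, (C l - X) with hP
  have hPj : P.eval j ≠ 0 := by
    have h : P.eval j = β j * ∏ l ∈ s.erase j, (l - j) := by
      simp only [hP, eval_finsetSum, eval_mul, eval_C, eval_prod, eval_sub, eval_X]
      refine Finset.sum_eq_single_of_mem j hj fun α _ hα => ?_
      exact mul_eq_zero_of_right _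
        (Finset.prod_eq_zero (Finset.mem_erase.2 ⟨hα.symm, hj⟩) (sub_self j))
    rw [h]
    refine mul_ne_zero hβ (Finset.prod_ne_zero_iff.2 fun l hl => ?_)
    exact sub_ne_zero.2 (Finset.ne_of_mem_erase hl)
  have hP0 : P ≠ 0 := by
    rintro h
    simp [h] at hPj
  -- Points of s are admitted outright: there one denominator is 0 and its inverse takes the value
  -- 0.
  refine (s.finite_toSet.union (P.roots.toFinset.finite_toSet)).subset fun x hx => ?_
  by_cases hxs : x ∈ s
  · exact Or.inl hxs
  refine Or.inr ?_
  simp only [Finset.mem_coe, Multiset.mem_toFinset, mem_roots hP0, IsRoot.def]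
  have h : P.eval x = (∑ α ∈ s, β α * (α - x)⁻¹) * ∏ l ∈ s, (l - x) := by
    simp only [hP, eval_finsetSum, eval_mul, eval_C, eval_prod, eval_sub, eval_X, Finset.sum_mul]
    refine Finset.sum_congr rfl fun α hα => ?_
    have hne : α - x ≠ 0 := sub_ne_zero.2 fun h => hxs (h ▸ hα)
    rw [← Finset.mul_prod_erase s _ hα]
    field_simp
  rw [h, hx, zero_mul]

/-- Every linear map from `C → k` to `V` kills a function with only finitely many zeros. -/
def KillsAlmostNonvanishing (k : Type v) (C : Type*) (V : Type w) [Field k] [AddCommGroup V]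
    [Module k V] : Prop :=
  ∀ g : (C → k) →ₗ[k] V, ∃ u : C → k, {x | u x = 0}.Finite ∧ g u = 0

/-- The functions x ↦ (α - x)⁻¹ are indexed by k, so their images in V are too many to be
independent. -/
theorem killsAlmostNonvanishing_of_rank_lt {k : Type v} {V : Type w} [Field k] [AddCommGroup V]
    [Module k V] (h : lift.{v} (Module.rank k V) < lift.{w} #k) :
    KillsAlmostNonvanishing k k V := by
  intro g
  let e : k → k → k := fun α x => (α - x)⁻¹
  have hdep : ¬ LinearIndependent k fun α => g (e α) := fun hli =>
    absurd hli.cardinal_lift_le_rank (not_le.2 h)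
  obtain ⟨s, β, hsum, j, hj, hβ⟩ := not_linearIndependent_iff.1 hdep
  refine ⟨∑ α ∈ s, β α • e α, ?_, by simpa using hsum⟩
  simpa [e] using finite_zeros_sum_inv_sub s β hj hβ

theorem KillsAlmostNonvanishing.of_injective {k : Type v} {C D : Type*} {V : Type w} [Field k]
    [AddCommGroup V] [Module k V] (h : KillsAlmostNonvanishing k C V) {φ : D → C}
    (hφ : Function.Injective φ) : KillsAlmostNonvanishing k D V := by
  intro g
  obtain ⟨u, hu, hgu⟩ := h (g ∘ₗ LinearMap.funLeft k k φ)
  exact ⟨u ∘ φ, hu.preimage hφ.injOn, hgu⟩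

/-- A continuum of functions `ℕ → k`, any two of which differ at almost all places, cannot be
mapped injectively into a space with fewer elements. -/
theorem killsAlmostNonvanishing_of_card_lt {k : Type v} {V : Type w} [Field k] [Infinite k]
    [AddCommGroup V] [Module k V] (h : #V < 2 ^ ℵ₀) : KillsAlmostNonvanishing k ℕ V := by
  intro g
  let φ : List Bool → k := fun l => Infinite.natEmbedding k (Encodable.encode l)
  have hφ : Function.Injective φ := (Infinite.natEmbedding k).injective.comp
    Encodable.encode_injective
  -- The n-th value encodes the first n bits, so sequences differing at m give different values at
  -- every n > m.
  let e : (ℕ → Bool) → ℕ → k := fun r n => φ ((List.range n).map r)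
  have hninj : ¬ Function.Injective fun r => g (e r) := by
    intro hinj
    have h2 := Cardinal.lift_mk_le_lift_mk_of_injective hinj
    simp only [mk_pi, mk_bool, prod_const, mk_nat, lift_ofNat, lift_aleph0, lift_power,
      lift_uzero] at h2
    exact absurd h2 (not_le.2 h)
  simp only [Function.Injective, not_forall] at hninj
  obtain ⟨r, s, hrs, hne⟩ := hninj
  obtain ⟨m, hm⟩ := Function.ne_iff.1 hne
  refine ⟨e r - e s, (Set.finite_Iic m).subset fun n hn => ?_, by simpa [sub_eq_zero] using hrs⟩
  by_contra hmn
  have h1 : (List.range n).map r = (List.range n).map s := hφ (sub_eq_zero.1 hn)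
  exact hm (List.map_inj_left.1 h1 m (List.mem_range.2 (by simpa using hmn)))

/-- If k has fewer than continuum many elements then so does V, and counting applies; otherwise the
dimension is below card k. -/
theorem killsAlmostNonvanishing_nat {k : Type v} {V : Type w} [Field k] [Infinite k]
    [AddCommGroup V] [Module k V] (h : Module.rank k V < 2 ^ ℵ₀) :
    KillsAlmostNonvanishing k ℕ V := by
  by_cases hk : #k < 2 ^ ℵ₀
  · refine killsAlmostNonvanishing_of_card_lt ?_
    let b := Module.Basis.ofVectorSpace k V
    have h1 := Cardinal.lift_mk_eq'.2 ⟨b.repr.toEquiv⟩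
    rcases isEmpty_or_nonempty (Module.Basis.ofVectorSpaceIndex k V) with he | he
    · have : Subsingleton V := b.repr.toEquiv.subsingleton
      have h2 : #V ≤ 1 := Cardinal.le_one_iff_subsingleton.2 this
      exact h2.trans_lt (one_lt_aleph0.trans (cantor _))
    · rw [Cardinal.mk_finsupp_lift_of_infinite', b.mk_eq_rank''] at h1
      have h2 : lift.{v} (Module.rank k V) < 2 ^ ℵ₀ := by simpa using lift_lt.{w, v}.2 h
      have h3 : lift.{w} #k < 2 ^ ℵ₀ := by simpa using lift_lt.{v, w}.2 hk
      have h4 := lift_lt.{max v w, w}.2 (max_lt h2 h3)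
      rw [← h1] at h4
      refine lift_lt.1 (h4.trans_eq ?_)
      simp
  · refine (killsAlmostNonvanishing_of_rank_lt ?_).of_injective (Infinite.natEmbedding k).injective
    calc lift.{v} (Module.rank k V) < lift.{v} (2 ^ ℵ₀) := lift_lt.2 h
      _ = lift.{w} (2 ^ ℵ₀) := by simp
      _ ≤ lift.{w} #k := lift_le.2 (not_lt.1 hk)

/-! ### Filters modulo which functions are finitely valued -/

section Filters

/-- Modulo `G`, every function from `I` to `C` takes finitely many values. -/
def FinitelyValued {I : Type u} (G : Filter I) (C : Type*) : Prop :=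
  ∀ c : I → C, ∃ S : Set C, S.Finite ∧ c ⁻¹' S ∈ G

theorem FinitelyValued.of_injective {I : Type u} {G : Filter I} {C D : Type*}
    (h : FinitelyValued G C) {φ : D → C} (hφ : Function.Injective φ) : FinitelyValued G D := by
  intro c
  obtain ⟨S, hS, hG⟩ := h (φ ∘ c)
  exact ⟨φ ⁻¹' S, hS.preimage hφ.injOn, hG⟩

theorem FinitelyValued.exists_fiber_mem {I : Type u} {G : Filter I} {C : Type*}
    (h : FinitelyValued G C) {U : Ultrafilter I} (hU : (U : Filter I) ≤ G) (c : I → C) :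
    ∃ x, c ⁻¹' {x} ∈ U := by
  obtain ⟨S, hS, hG⟩ := h c
  have h1 : (⋃ x ∈ S, c ⁻¹' {x}) ∈ U := by
    rw [← Set.preimage_iUnion₂, Set.biUnion_of_singleton]
    exact hU hG
  obtain ⟨x, -, hx⟩ := (Ultrafilter.finite_biUnion_mem_iff hS).1 h1
  exact ⟨x, hx⟩

/-- If the intersection of a family of members of an ultrafilter is not a member, then sending each
index outside of it to a set of the family that omits this index has no fiber in the
ultrafilter. -/
theorem exists_fibers_notMem {I : Type u} (U : Ultrafilter I) (S : Set (Set I))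
    (hS : ∀ J ∈ S, J ∈ U) (hinter : ⋂₀ S ∉ U) : ∃ c : I → S, ∀ x, c ⁻¹' {x} ∉ U := by
  classical
  have hne : (⋂₀ S)ᶜ ∈ U := Ultrafilter.compl_mem_iff_notMem.2 hinter
  have hex : ∀ i ∈ (⋂₀ S)ᶜ, ∃ J : S, i ∉ J.1 := by
    intro i hi
    simpa using hi
  obtain ⟨i₀, hi₀⟩ := U.nonempty_of_mem hne
  let c : I → S := fun i => if hi : i ∈ (⋂₀ S)ᶜ then (hex i hi).choose else (hex i₀ hi₀).choose
  refine ⟨c, fun x hx => ?_⟩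
  obtain ⟨i, ⟨hix, hi⟩, hiJ⟩ :=
    U.nonempty_of_mem (Filter.inter_mem (Filter.inter_mem hx hne) (hS x x.2))
  have hc : c i = (hex i hi).choose := dif_pos hi
  have := (hex i hi).choose_spec
  rw [← hc, show c i = x from hix] at this
  exact this hiJ

theorem FinitelyValued.isCompleteFilter {I : Type u} {G : Filter I} {C : Type v}
    (h : FinitelyValued G C) {U : Ultrafilter I} (hU : (U : Filter I) ≤ G) :
    IsCompleteFilter (U : Filter I) (Order.succ #C) := by
  intro S hcard hS
  by_contra hinter
  obtain ⟨c, hc⟩ := exists_fibers_notMem U S hS hinter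
  rw [lift_succ, Order.lt_succ_iff, Cardinal.lift_mk_le'] at hcard
  obtain ⟨e⟩ := hcard
  obtain ⟨x, hx⟩ := (h.of_injective e.injective).exists_fiber_mem hU c
  exact hc x hx

/-- An infinite Hausdorff space has infinitely many disjoint nonempty open sets. Basic open subsets
of these give sets J n, no two in a common ultrafilter finer than G; the index of the first J n
containing i is then not finitely valued. -/
theorem FinitelyValued.finite_ultrafilters {I : Type u} {G : Filter I}
    (h : FinitelyValued G ℕ) : {U : Ultrafilter I | (U : Filter I) ≤ G}.Finite := by
  classical
  by_contra hinf
  have : Infinite {U : Ultrafilter I | (U : Filter I) ≤ G} := Set.infinite_coe_iff.2 hinf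
  obtain ⟨O, hO, hopen, hdisj⟩ :=
    exists_seq_infinite_isOpen_pairwise_disjoint {U : Ultrafilter I | (U : Filter I) ≤ G}
  have key : ∀ n, ∃ (V : {U : Ultrafilter I | (U : Filter I) ≤ G}) (J : Set I), J ∈ V.1 ∧
      ∀ W : {U : Ultrafilter I | (U : Filter I) ≤ G}, J ∈ W.1 → W ∈ O n := by
    intro n
    obtain ⟨V, hV⟩ := (hO n).nonempty
    obtain ⟨T, hT, hTO⟩ := isOpen_induced_iff.1 (hopen n)
    have hVT : V.1 ∈ T := by rw [← hTO] at hV; exact hV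
    obtain ⟨_, ⟨J, rfl⟩, hJ, hJT⟩ := ultrafilterBasis_is_basis.exists_subset_of_mem_open hVT hT
    exact ⟨V, J, hJ, fun W hW => by rw [← hTO]; exact hJT hW⟩
  choose V J hJ hJO using key
  let c : I → ℕ := fun i => if hi : ∃ n, i ∈ J n then Nat.find hi else 0
  obtain ⟨S, hS, hG⟩ := h c
  obtain ⟨n, hn⟩ := hS.infinite_compl.nonempty
  have hlt : ∀ m ∈ Finset.range n, (J m)ᶜ ∈ (V n).1 := by
    intro m hm
    refine Ultrafilter.compl_mem_iff_notMem.2 fun hmem => ?_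
    have hmn : m ≠ n := (Finset.mem_range.1 hm).ne
    exact Set.disjoint_left.1 (hdisj hmn) (hJO m _ hmem) (hJO n _ (hJ n))
  have hall : (⋂ m ∈ Finset.range n, (J m)ᶜ) ∈ (V n).1 := (Filter.biInter_finset_mem _).2 hlt
  obtain ⟨i, ⟨hiS, hin⟩, hi⟩ := (V n).1.nonempty_of_mem
    (Filter.inter_mem (Filter.inter_mem ((V n).2 hG) (hJ n)) hall)
  have hex : ∃ n, i ∈ J n := ⟨n, hin⟩
  have hci : c i = n := by
    simp only [c, dif_pos hex]
    refine (Nat.find_eq_iff hex).2 ⟨hin, fun m hm => ?_⟩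
    exact Set.mem_iInter₂.1 hi m (Finset.mem_range.2 hm)
  exact hn (hci ▸ hiS)

/-- A nonprincipal ultrafilter on `I` yields a measurable cardinal at most `#I`, not below its
degree of completeness. -/
theorem exists_isMeasurableCardinal_of_nonprincipal {I : Type u} (U : Ultrafilter I)
    (hU : ∀ i, U ≠ pure i) (κ : Cardinal.{v}) (hκ : IsCompleteFilter (U : Filter I) κ) :
    ∃ μ : Cardinal.{u}, IsMeasurableCardinal μ ∧ lift.{u} κ ≤ lift.{v} μ ∧ μ ≤ #I := by
  classical
  -- The measurable cardinal is the least size of a family in U with intersection outside U.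
  -- Minimality gives completeness of the ultrafilter pushed forward to that family.
  let bad : Set Cardinal.{u} := {μ | ∃ S : Set (Set I), #S = μ ∧ (∀ J ∈ S, J ∈ U) ∧ ⋂₀ S ∉ U}
  let S₀ : Set (Set I) := Set.range fun i : I => ({i} : Set I)ᶜ
  have hS₀ : #S₀ ∈ bad := by
    refine ⟨S₀, rfl, ?_, ?_⟩
    · rintro _ ⟨i, rfl⟩
      refine Ultrafilter.compl_mem_iff_notMem.2 fun hi => hU i ?_
      exact (Ultrafilter.coe_le_coe.1 (Filter.le_pure_iff.2 hi))
    · have : ⋂₀ S₀ = ∅ := by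
        ext i
        simp [S₀]
      rw [this]
      exact U.empty_notMem
  obtain ⟨S, hSμ, hSU, hSinter⟩ := csInf_mem (⟨_, hS₀⟩ : bad.Nonempty)
  have hmin : ∀ T : Set (Set I), #T < #S → (∀ J ∈ T, J ∈ U) → ⋂₀ T ∈ U := by
    intro T hT hTU
    by_contra hTinter
    exact absurd (csInf_le' (s := bad) ⟨T, rfl, hTU, hTinter⟩) (not_le.2 (hSμ ▸ hT))
  refine ⟨#S, ⟨?_, ?_⟩, ?_, ?_⟩
  · by_contra hfin
    have : S.Finite := Cardinal.lt_aleph0_iff_set_finite.1 (not_le.1 hfin)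
    exact hSinter ((Filter.sInter_mem this).2 hSU)
  · obtain ⟨c, hc⟩ := exists_fibers_notMem U S hSU hSinter
    let e : S ≃ (#S).out := Cardinal.outMkEquiv.symm
    refine ⟨U.map (e ∘ c), fun x hx => hc (e.symm x) ?_, fun T hT hTU => ?_⟩
    · have h1 : ({x} : Set (#S).out) ∈ U.map (e ∘ c) := by rw [hx]; exact Set.mem_singleton x
      have h2 : c ⁻¹' {e.symm x} = (e ∘ c) ⁻¹' {x} := by
        ext i
        simp [Equiv.eq_symm_apply]
      rw [h2]
      exact h1
    · have h1 : ⋂₀ (Set.preimage (e ∘ c) '' T) ∈ U := by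
        refine hmin _ (Cardinal.mk_image_le.trans_lt (by simpa using hT)) ?_
        rintro _ ⟨J, hJ, rfl⟩
        exact hTU J hJ
      have h2 : ⋂₀ (Set.preimage (e ∘ c) '' T) = (e ∘ c) ⁻¹' (⋂₀ T) := by
        rw [Set.sInter_image, Set.preimage_sInter]
      rw [h2] at h1
      exact h1
  · by_contra hlt
    exact hSinter (hκ S (not_le.1 hlt) hSU)
  · rw [hSμ]
    exact (csInf_le' hS₀).trans Cardinal.mk_range_le

end Filters

/-! ### Factoring homomorphisms on a product -/

section Homomorphisms

variable {k : Type v} [Field k] {I : Type u} {A : I → Type a}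
  [∀ i, NonUnitalNonAssocRing (A i)] [∀ i, Module k (A i)]
  {B : Type w} [NonUnitalNonAssocRing B] [Module k B]

open Classical in
/-- The endomorphism of `∏ A_i` that replaces the components outside `J` by `0`. -/
noncomputable def restrictHom (k : Type v) [Field k] {I : Type u} (A : I → Type a)
    [∀ i, NonUnitalNonAssocRing (A i)] [∀ i, Module k (A i)] (J : Set I) :
    (∀ i, A i) →ₙₐ[k] (∀ i, A i) where
  toFun x i := if i ∈ J then x i else 0
  map_smul' c x := by ext i; by_cases h : i ∈ J <;> simp [h]
  map_zero' := by ext i; simp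
  map_add' x y := by ext i; by_cases h : i ∈ J <;> simp [h]
  map_mul' x y := by ext i; by_cases h : i ∈ J <;> simp [h]

theorem restrictHom_of_mem {J : Set I} {i : I} (hi : i ∈ J) (x : ∀ i, A i) :
    restrictHom k A J x i = x i := if_pos hi

theorem restrictHom_of_notMem {J : Set I} {i : I} (hi : i ∉ J) (x : ∀ i, A i) :
    restrictHom k A J x i = 0 := if_neg hi

theorem restrictHom_add_compl (J : Set I) (x : ∀ i, A i) :
    restrictHom k A J x + restrictHom k A Jᶜ x = x := by
  ext i
  by_cases h : i ∈ J
  · simp [restrictHom_of_mem h, restrictHom_of_notMem (show i ∉ Jᶜ from fun h' => h' h)]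
  · simp [restrictHom_of_notMem h, restrictHom_of_mem (show i ∈ Jᶜ from h)]

open Classical in
/-- Extension by zero from the subproduct indexed by `s`. -/
noncomputable def extendHom (k : Type v) [Field k] {I : Type u} (A : I → Type a)
    [∀ i, NonUnitalNonAssocRing (A i)] [∀ i, Module k (A i)] (s : Finset I) :
    (∀ i : s, A i) →ₙₐ[k] (∀ i, A i) where
  toFun x i := if h : i ∈ s then x ⟨i, h⟩ else 0
  map_smul' c x := by ext i; by_cases h : i ∈ s <;> simp [h]
  map_zero' := by ext i; simp
  map_add' x y := by ext i; by_cases h : i ∈ s <;> simp [h]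
  map_mul' x y := by ext i; by_cases h : i ∈ s <;> simp [h]

theorem extendHom_restrict (s : Finset I) (x : ∀ i, A i) :
    extendHom k A s (fun i => x i) = restrictHom k A (s : Set I) x := by
  ext i
  by_cases h : i ∈ s
  · rw [restrictHom_of_mem (Finset.mem_coe.2 h)]
    exact dif_pos h
  · rw [restrictHom_of_notMem (mt Finset.mem_coe.1 h)]
    exact dif_neg h

theorem factorsThroughSubproduct_comp_restrictHom (h : (∀ i, A i) →ₙₐ[k] B) (s : Finset I) :
    FactorsThroughSubproduct (h.comp (restrictHom k A (s : Set I))) s :=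
  ⟨h.comp (extendHom k A s), fun x => (congrArg h (extendHom_restrict (k := k) s x)).symm⟩

/-- A homomorphism on `∏ A_i` that kills every element vanishing in all of finitely many distinct
ultraproducts factors through the product of these. -/
theorem exists_factor_ultraproducts (h : (∀ i, A i) →ₙₐ[k] B) {n : ℕ}
    (U : Fin n → Ultrafilter I) (hU : Function.Injective U)
    (hker : ∀ x : ∀ i, A i, (∀ m, ∀ᶠ i in (U m : Filter I), x i = 0) → h x = 0) :
    ∃ g : (∀ m : Fin n, ReducedProduct k A (U m : Filter I)) →ₙₐ[k] B,
      ∀ x : ∀ i, A i, h x = g fun m => (reducedIdeal k A (U m : Filter I)).mkHom x := by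
  classical
  have hdisj : Pairwise (Function.onFun Disjoint fun m => (U m : Filter I)) := by
    intro l m hlm
    refine (U l).disjoint_iff_not_le.2 fun hle => hU.ne hlm ?_
    exact Ultrafilter.coe_le_coe.1 hle
  obtain ⟨J, hJU, hJ⟩ := hdisj.exists_mem_filter_of_disjoint
  let p : (∀ i, A i) → ∀ m : Fin n, ReducedProduct k A (U m : Filter I) :=
    fun x m => (reducedIdeal k A (U m : Filter I)).mkHom x
  have hp : Function.Surjective p := by
    intro y
    choose z hz using fun m => (reducedIdeal k A (U m : Filter I)).cls_surjective (y m)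
    -- Representatives are glued along the disjoint members J m.
    refine ⟨fun i => if hi : ∃ m, i ∈ J m then z hi.choose i else 0, funext fun m => ?_⟩
    refine Eq.trans ?_ (hz m)
    refine (reducedIdeal_mk_eq_iff k A _ _ _).2 (Filter.mem_of_superset (hJU m) fun i hi => ?_)
    have hex : ∃ m, i ∈ J m := ⟨m, hi⟩
    have hm : hex.choose = m := by
      by_contra hne
      exact Set.disjoint_left.1 (hJ hne) hex.choose_spec hi
    simp only [Set.mem_ofPred_eq, dif_pos hex, hm]
  have hpeq : ∀ x y, p x = p y → h x = h y := by
    intro x y hxy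
    rw [← sub_eq_zero, ← map_sub]
    refine hker _ fun m => ?_
    have := (reducedIdeal_mk_eq_iff k A _ _ _).1 (congrFun hxy m)
    filter_upwards [this] with i hi
    exact sub_eq_zero.2 hi
  -- q is only a set-theoretic section; `h ∘ q` is a homomorphism because h is constant on the
  -- fibers of p.
  choose q hq using hp
  have hqp : ∀ x, h (q (p x)) = h x := fun x => hpeq _ _ (hq _)
  refine ⟨{ toFun := fun y => h (q y), map_smul' := ?_, map_zero' := ?_, map_add' := ?_,
            map_mul' := ?_ }, fun x => (hqp x).symm⟩
  · intro c y
    refine Eq.trans (hpeq _ (c • q y) ?_) (map_smul h c _)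
    rw [hq]
    conv_lhs => rw [← hq y]
    exact funext fun m => (map_smul (reducedIdeal k A (U m : Filter I)).mkHom c _).symm
  · refine Eq.trans (hpeq _ 0 ?_) (map_zero h)
    rw [hq]
    exact funext fun m => (map_zero (reducedIdeal k A (U m : Filter I)).mkHom).symm
  · intro y y'
    refine Eq.trans (hpeq _ (q y + q y') ?_) (map_add h _ _)
    rw [hq]
    conv_lhs => rw [← hq y, ← hq y']
    exact funext fun m => (map_add (reducedIdeal k A (U m : Filter I)).mkHom _ _).symm
  · intro y y'
    refine Eq.trans (hpeq _ (q y * q y') ?_) (map_mul h _ _)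
    rw [hq]
    conv_lhs => rw [← hq y, ← hq y']
    exact funext fun m => (map_mul (reducedIdeal k A (U m : Filter I)).mkHom _ _).symm

variable [IsScalarTower k B B] [SMulCommClass k B B]

theorem mem_totalAnnihilator {x : B} :
    x ∈ (totalAnnihilator k B).toSubmodule ↔ ∀ y : B, x * y = 0 ∧ y * x = 0 := Iff.rfl

/-- The filter of those sets `J` such that `f` maps the elements vanishing on `J` into `Z(B)`. -/
def nullFilter (f : (∀ i, A i) →ₙₐ[k] B) : Filter I where
  sets := {J | ∀ x : ∀ i, A i, (∀ i ∈ J, x i = 0) → f x ∈ (totalAnnihilator k B).toSubmodule}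
  univ_sets := by
    intro x hx
    rw [show x = 0 from funext fun i => hx i trivial, map_zero]
    exact Submodule.zero_mem _
  sets_of_superset := fun hJ hJK x hx => hJ x fun i hi => hx i (hJK hi)
  inter_sets := by
    intro J K hJ hK x hx
    rw [← restrictHom_add_compl (k := k) J x, map_add]
    -- The part of x on J vanishes on K, and the part off J vanishes on J.
    refine Submodule.add_mem _ (hK _ fun i hi => ?_) (hJ _ fun i hi => ?_)
    · by_cases hiJ : i ∈ J
      · rw [restrictHom_of_mem hiJ, hx i ⟨hiJ, hi⟩]
      · exact restrictHom_of_notMem hiJ x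
    · exact restrictHom_of_notMem (Set.notMem_compl_iff.2 hi) x

theorem mem_nullFilter {f : (∀ i, A i) →ₙₐ[k] B} {J : Set I} :
    J ∈ nullFilter f ↔ ∀ x : ∀ i, A i, (∀ i ∈ J, x i = 0) →
      f x ∈ (totalAnnihilator k B).toSubmodule := Iff.rfl

theorem map_mem_of_eventually_nullFilter {f : (∀ i, A i) →ₙₐ[k] B} {x : ∀ i, A i}
    (hx : ∀ᶠ i in nullFilter f, x i = 0) : f x ∈ (totalAnnihilator k B).toSubmodule :=
  mem_nullFilter.1 hx x fun _ hi => hi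

theorem mkHom_eq_zero_iff {x : B} :
    (totalAnnihilator k B).mkHom x = 0 ↔ x ∈ (totalAnnihilator k B).toSubmodule :=
  Submodule.Quotient.mk_eq_zero _

theorem factorsThroughUltraproducts_of_finitelyValued {f : (∀ i, A i) →ₙₐ[k] B}
    {C : Type v} [Infinite C] (h : FinitelyValued (nullFilter f) C) :
    FactorsThroughUltraproducts ((totalAnnihilator k B).mkHom.comp f) (Order.succ #C) := by
  have hfin := (h.of_injective (Infinite.natEmbedding C).injective).finite_ultrafilters
  obtain ⟨n, U, hUinj, hUrange⟩ := hfin.fin_param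
  have hU : ∀ m, (U m : Filter I) ≤ nullFilter f := fun m => by
    have : U m ∈ Set.range U := ⟨m, rfl⟩
    rw [hUrange] at this
    exact this
  refine ⟨n, U, fun m => h.isCompleteFilter (hU m),
    exists_factor_ultraproducts _ U hUinj fun x hx => ?_⟩
  refine mkHom_eq_zero_iff.2 (map_mem_of_eventually_nullFilter ?_)
  -- A filter is the intersection of the ultrafilters refining it.
  refine Filter.mem_iff_ultrafilter.2 fun V hV => ?_
  obtain ⟨m, rfl⟩ : V ∈ Set.range U := by rw [hUrange]; exact hV
  exact hx m

theorem exists_finset_mem_nullFilter {f : (∀ i, A i) →ₙₐ[k] B}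
    {C : Type v} [Infinite C] (h : FinitelyValued (nullFilter f) C)
    (hI : ∀ μ : Cardinal.{u}, IsMeasurableCardinal μ → lift.{u} #C < lift.{v} μ → #I < μ) :
    ∃ s : Finset I, (s : Set I) ∈ nullFilter f := by
  have hfin := (h.of_injective (Infinite.natEmbedding C).injective).finite_ultrafilters
  have hprinc : ∀ U : Ultrafilter I, (U : Filter I) ≤ nullFilter f → ∃ i, U = pure i := by
    intro U hU
    by_contra! hne
    obtain ⟨μ, hμ, hle, hμI⟩ :=
      exists_isMeasurableCardinal_of_nonprincipal U hne _ (h.isCompleteFilter hU)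
    rw [lift_succ, Order.succ_le_iff] at hle
    exact absurd hμI (not_le.2 (hI μ hμ hle))
  have hsfin : {i : I | (pure i : Filter I) ≤ nullFilter f}.Finite :=
    Set.Finite.preimage (f := (pure : I → Ultrafilter I)) Ultrafilter.pure_injective.injOn hfin
  refine ⟨hsfin.toFinset, Filter.mem_iff_ultrafilter.2 fun U hU => ?_⟩
  obtain ⟨i, rfl⟩ := hprinc U hU
  simpa using hU

theorem factorsThroughSubproduct_of_mem_nullFilter {f : (∀ i, A i) →ₙₐ[k] B} {s : Finset I}
    (hs : (s : Set I) ∈ nullFilter f) :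
    FactorsThroughSubproduct ((totalAnnihilator k B).mkHom.comp f) s ∧
      ∃ f₁ f₀ : (∀ i, A i) →ₙₐ[k] B, FactorsThroughSubproduct f₁ s ∧
        (∀ x, f₀ x ∈ (totalAnnihilator k B).toSubmodule) ∧ ∀ x, f x = f₁ x + f₀ x := by
  have hsplit : ∀ x, f x = f (restrictHom k A (s : Set I) x) +
      f (restrictHom k A (s : Set I)ᶜ x) := fun x => by
    rw [← map_add, restrictHom_add_compl]
  have hnull : ∀ x, f (restrictHom k A (s : Set I)ᶜ x) ∈ (totalAnnihilator k B).toSubmodule :=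
    fun x => mem_nullFilter.1 hs _ fun i hi => restrictHom_of_notMem (Set.notMem_compl_iff.2 hi) x
  refine ⟨?_, f.comp (restrictHom k A (s : Set I)), f.comp (restrictHom k A (s : Set I)ᶜ),
    factorsThroughSubproduct_comp_restrictHom f s, hnull, hsplit⟩
  obtain ⟨g, hg⟩ := factorsThroughSubproduct_comp_restrictHom
    ((totalAnnihilator k B).mkHom.comp f) s
  refine ⟨g, fun x => ?_⟩
  rw [← hg]
  simp only [NonUnitalAlgHom.comp_apply]
  rw [hsplit x, map_add, mkHom_eq_zero_iff.2 (hnull x), add_zero]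

/-! ### Finite-valuedness modulo the filter of a homomorphism -/

variable [∀ i, IsScalarTower k (A i) (A i)] [∀ i, SMulCommClass k (A i) (A i)]

/-- If `f` kills `u • y`, then it maps every `x` that agrees with `y` where `u ≠ 0`, and vanishes
elsewhere, into `Z(B)`. -/
theorem map_mem_totalAnnihilator_of_map_smul_eq_zero {f : (∀ i, A i) →ₙₐ[k] B}
    (hf : Function.Surjective f) {u : I → k} {y : ∀ i, A i}
    (hu : f (fun i => u i • y i) = 0) {x : ∀ i, A i} (hx : ∀ i, x i = 0 ∨ u i ≠ 0 ∧ x i = y i) :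
    f x ∈ (totalAnnihilator k B).toSubmodule := by
  classical
  refine mem_totalAnnihilator.2 fun z => ?_
  obtain ⟨b, rfl⟩ := hf z
  -- Moving u from y onto b turns x * b and b * x into products with the killed element.
  let b' : ∀ i, A i := fun i => if x i = 0 then 0 else (u i)⁻¹ • b i
  have h1 : x * b = (fun i => u i • y i) * b' := by
    ext i
    rcases eq_or_ne (x i) 0 with h | h
    · simp [b', h]
    · obtain ⟨hu, hxy⟩ := (hx i).resolve_left h
      simp only [Pi.mul_apply, b', if_neg h]
      rw [smul_mul_smul_comm, mul_inv_cancel₀ hu, one_smul, hxy]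
  have h2 : b * x = b' * (fun i => u i • y i) := by
    ext i
    rcases eq_or_ne (x i) 0 with h | h
    · simp [b', h]
    · obtain ⟨hu, hxy⟩ := (hx i).resolve_left h
      simp only [Pi.mul_apply, b', if_neg h]
      rw [smul_mul_smul_comm, inv_mul_cancel₀ hu, one_smul, hxy]
  constructor
  · rw [← map_mul, h1, map_mul, hu, zero_mul]
  · rw [← map_mul, h2, map_mul, hu, mul_zero]

/-- For each element `y` and each `c : I → C`, all but finitely many fibers of `c` can be ignored
as far as `y` is concerned. -/
theorem exists_finite_forall_map_mem {f : (∀ i, A i) →ₙₐ[k] B} (hf : Function.Surjective f)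
    {C : Type*} (hC : KillsAlmostNonvanishing k C B) (c : I → C) (y : ∀ i, A i) :
    ∃ S : Set C, S.Finite ∧ ∀ x : ∀ i, A i, (∀ i, x i = 0 ∨ c i ∉ S ∧ x i = y i) →
      f x ∈ (totalAnnihilator k B).toSubmodule := by
  let g : (C → k) →ₗ[k] B :=
    { toFun := fun u => f fun i => u (c i) • y i
      map_add' := fun u u' => by
        rw [← map_add]
        exact congrArg f (funext fun i => add_smul _ _ _)
      map_smul' := fun r u => by
        rw [RingHom.id_apply, ← map_smul]
        exact congrArg f (funext fun i => mul_smul _ _ _) }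
  obtain ⟨u, hu, hgu⟩ := hC g
  exact ⟨_, hu, fun x hx => map_mem_totalAnnihilator_of_map_smul_eq_zero (u := u ∘ c) hf hgu hx⟩

theorem finitelyValued_nullFilter {f : (∀ i, A i) →ₙₐ[k] B} (hf : Function.Surjective f)
    {C : Type*} (hC : KillsAlmostNonvanishing k C B) : FinitelyValued (nullFilter f) C := by
  classical
  intro c
  -- For each fiber that is not negligible, x is a witness supported on it. Gluing the witnesses
  -- into one element tests all fibers at once.
  have hex : ∀ t : C, ∃ x : ∀ i, A i, (∀ i, c i ≠ t → x i = 0) ∧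
      (f x ∈ (totalAnnihilator k B).toSubmodule → (c ⁻¹' {t})ᶜ ∈ nullFilter f) := by
    intro t
    by_cases ht : (c ⁻¹' {t})ᶜ ∈ nullFilter f
    · exact ⟨0, fun _ _ => rfl, fun _ => ht⟩
    · rw [mem_nullFilter] at ht
      push Not at ht
      obtain ⟨x, hx, hfx⟩ := ht
      exact ⟨x, hx, fun h => absurd h hfx⟩
  choose w hw hfw using hex
  obtain ⟨S, hS, hSw⟩ := exists_finite_forall_map_mem hf hC c fun i => w (c i) i
  have hfib : ∀ t ∉ S, (c ⁻¹' {t})ᶜ ∈ nullFilter f := by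
    intro t ht
    refine hfw t (hSw _ fun i => ?_)
    by_cases hi : c i = t
    · exact Or.inr ⟨hi ▸ ht, by rw [hi]⟩
    · exact Or.inl (hw t i hi)
  refine ⟨S, hS, mem_nullFilter.2 fun x hx => ?_⟩
  -- T depends on x, but over T only finitely many fibers outside S matter, and each of them is
  -- negligible.
  obtain ⟨T, hT, hTx⟩ := exists_finite_forall_map_mem hf hC c x
  rw [← restrictHom_add_compl (k := k) (c ⁻¹' T) x, map_add]
  refine Submodule.add_mem _ ?_ (hTx _ fun i => ?_)
  · refine map_mem_of_eventually_nullFilter ?_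
    have hmem : (⋂ t ∈ T \ S, (c ⁻¹' {t})ᶜ) ∈ nullFilter f :=
      (Filter.biInter_mem (hT.subset Set.sdiff_subset)).2 fun t ht => hfib t ht.2
    filter_upwards [hmem] with i hi
    by_cases hiT : c i ∈ T
    · by_cases hiS : c i ∈ S
      · rw [restrictHom_of_mem (J := c ⁻¹' T) hiT, hx i hiS]
      · exact absurd rfl (Set.mem_iInter₂.1 hi (c i) ⟨hiT, hiS⟩)
    · exact restrictHom_of_notMem (J := c ⁻¹' T) hiT x
  · by_cases hiT : c i ∈ T
    · exact Or.inl (restrictHom_of_notMem (Set.notMem_compl_iff.2 (show i ∈ c ⁻¹' T from hiT)) x)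
    · exact Or.inr ⟨hiT, restrictHom_of_mem (J := (c ⁻¹' T)ᶜ) hiT x⟩

end Homomorphisms

theorem theorem3p1 {k : Type v} [Field k] [Infinite k] {I : Type u} {A : I → Type a}
    [∀ i, NonUnitalNonAssocRing (A i)] [∀ i, Module k (A i)]
    [∀ i, IsScalarTower k (A i) (A i)] [∀ i, SMulCommClass k (A i) (A i)]
    {B : Type w} [NonUnitalNonAssocRing B] [Module k B]
    [IsScalarTower k B B] [SMulCommClass k B B]
    (f : (∀ i, A i) →ₙₐ[k] B) (hf : Function.Surjective f) :
    -- case (i)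
    (lift.{v} (Module.rank k B) < lift.{w} #k →
      FactorsThroughUltraproducts ((totalAnnihilator k B).mkHom.comp f) (Order.succ #k) ∧
      ((∀ μ : Cardinal.{u}, IsMeasurableCardinal μ → lift.{u} #k < lift.{v} μ → #I < μ) →
        ∃ s : Finset I, FactorsThroughSubproduct ((totalAnnihilator k B).mkHom.comp f) s ∧
          ∃ f₁ f₀ : (∀ i, A i) →ₙₐ[k] B, FactorsThroughSubproduct f₁ s ∧
            (∀ x, f₀ x ∈ (totalAnnihilator k B).toSubmodule) ∧ ∀ x, f x = f₁ x + f₀ x)) ∧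
    -- case (ii)
    (Module.rank k B < 2 ^ ℵ₀ →
      FactorsThroughUltraproducts ((totalAnnihilator k B).mkHom.comp f) ℵ₁ ∧
      ((∀ μ : Cardinal.{u}, IsMeasurableCardinal μ → ℵ₀ < μ → #I < μ) →
        ∃ s : Finset I, FactorsThroughSubproduct ((totalAnnihilator k B).mkHom.comp f) s ∧
          ∃ f₁ f₀ : (∀ i, A i) →ₙₐ[k] B, FactorsThroughSubproduct f₁ s ∧
            (∀ x, f₀ x ∈ (totalAnnihilator k B).toSubmodule) ∧ ∀ x, f x = f₁ x + f₀ x)) := by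
  have main : ∀ (C : Type v) [Infinite C], KillsAlmostNonvanishing k C B →
      FactorsThroughUltraproducts ((totalAnnihilator k B).mkHom.comp f) (Order.succ #C) ∧
      ((∀ μ : Cardinal.{u}, IsMeasurableCardinal μ → lift.{u} #C < lift.{v} μ → #I < μ) →
        ∃ s : Finset I, FactorsThroughSubproduct ((totalAnnihilator k B).mkHom.comp f) s ∧
          ∃ f₁ f₀ : (∀ i, A i) →ₙₐ[k] B, FactorsThroughSubproduct f₁ s ∧
            (∀ x, f₀ x ∈ (totalAnnihilator k B).toSubmodule) ∧ ∀ x, f x = f₁ x + f₀ x) := by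
    intro C _ hC
    have hval := finitelyValued_nullFilter hf hC
    refine ⟨factorsThroughUltraproducts_of_finitelyValued hval, fun hI => ?_⟩
    obtain ⟨s, hs⟩ := exists_finset_mem_nullFilter hval hI
    exact ⟨s, factorsThroughSubproduct_of_mem_nullFilter hs⟩
  refine ⟨fun hdim => main k (killsAlmostNonvanishing_of_rank_lt hdim), fun hdim => ?_⟩
  -- ℕ is lifted to the universe of k, as `main` requires.
  have h := main (ULift.{v} ℕ) ((killsAlmostNonvanishing_nat hdim).of_injective
    Equiv.ulift.injective)
  simpa [succ_aleph0] using h
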